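/- Let $q$ be a prime power and let $m\ge 1$ be an integer. For an integer $r\ge 0$ let $R_q(r,m)\subseteq \mathbb F_q^{\,q^m}$ be the generalized Reed–Muller code of order $r$, i.e. the set of all functions $f:\mathbb F_q^m\to\mathbb F_q$ such that the unique polynomial in $\mathbb F_q[X_1,\dots,X_m]$ of degree at most $q-1$ in each variable that represents $f$ has total degree at most $r$. For $f:\mathbb F_q^m\to\mathbb F_q$ let $|f|=\mathrm{Card}\{x\in\mathbb F_q^m : f(x)\ne 0\}$ be its Hamming weight, and let $$\rho_2(1,m)=\max_{f\in R_q(2,m)}\ \min_{c\in R_q(1,m)}|f-c|$$ be the covering radius of $R_q(1,m)$ in $R_q(2,m)$. Then $$\rho_2(1,m)=(q-1)q^{m-1}-q^{\lceil m/2\rceil-1}.$$ -/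

import Mathlib

open MvPolynomial

/-- The generalized Reed–Muller code `R_q(r, m)` over the finite field `F` with `q` elements:
the functions `F^m → F` whose representing polynomial of degree at most `q - 1` in each variable
has total degree at most `r`. A code of length `q^m` is viewed as a space of functions
`F^m → F`, and `P` is identified with `(P(x))_{x ∈ F^m}`. -/
noncomputable def reedMuller (F : Type*) [Field F] [Fintype F] (r m : ℕ) :
    Submodule F ((Fin m → F) → F) :=
  (restrictDegree (Fin m) F (Fintype.card F - 1) ⊓ restrictTotalDegree (Fin m) F r).map
    (evalₗ F (Fin m))

theorem mem_reedMuller (F : Type*) [Field F] [Fintype F] (r m : ℕ) (f : (Fin m → F) → F) :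
    f ∈ reedMuller F r m ↔ ∃ P : MvPolynomial (Fin m) F,
      (∀ i, P.degreeOf i ≤ Fintype.card F - 1) ∧ P.totalDegree ≤ r ∧
        ∀ x, eval x P = f x := by
  simp only [reedMuller, Submodule.mem_map, Submodule.mem_inf, mem_restrictTotalDegree,
    mem_restrictDegree, and_assoc, degreeOf_le_iff, funext_iff, evalₗ_apply]
  constructor
  · rintro ⟨P, h1, h2, h3⟩
    exact ⟨P, fun i s hs => h1 s hs i, h2, h3⟩
  · rintro ⟨P, h1, h2, h3⟩
    exact ⟨P, fun s hs i => h1 i s hs, h2, h3⟩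

/-- The Hamming distance `min_{c ∈ C} |x - c|` from a word `x` to a linear code `C`. -/
noncomputable def distToCode {ι F : Type*} [Fintype ι] [Field F] [DecidableEq F]
    (C : Submodule F (ι → F)) (x : ι → F) : ℕ :=
  sInf {d | ∃ c ∈ C, hammingNorm (x - c) = d}

/-- The covering radius `max_{x ∈ D} min_{c ∈ C} |x - c|` of the linear code `C` in the linear
code `D`. -/
noncomputable def coveringRadiusIn {ι F : Type*} [Fintype ι] [Field F] [DecidableEq F]
    (C D : Submodule F (ι → F)) : ℕ :=
  sSup {d | ∃ x ∈ D, distToCode C x = d}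

/-- The infimum in `distToCode` is a minimum. -/
theorem isLeast_distToCode {ι F : Type*} [Fintype ι] [Field F] [DecidableEq F]
    (C : Submodule F (ι → F)) (x : ι → F) :
    IsLeast {d | ∃ c ∈ C, hammingNorm (x - c) = d} (distToCode C x) :=
  have hne : {d | ∃ c ∈ C, hammingNorm (x - c) = d}.Nonempty := ⟨_, 0, C.zero_mem, rfl⟩
  ⟨Nat.sInf_mem hne, fun _ hd => Nat.sInf_le hd⟩

/-- The supremum in `coveringRadiusIn` is a maximum. -/
theorem isGreatest_coveringRadiusIn {ι F : Type*} [Fintype ι] [Field F] [DecidableEq F]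
    (C D : Submodule F (ι → F)) :
    IsGreatest {d | ∃ x ∈ D, distToCode C x = d} (coveringRadiusIn C D) := by
  have hb : BddAbove {d | ∃ x ∈ D, distToCode C x = d} := by
    refine ⟨Fintype.card ι, ?_⟩
    rintro d ⟨x, -, rfl⟩
    exact ((isLeast_distToCode C x).2 ⟨0, C.zero_mem, rfl⟩).trans hammingNorm_le_card_fintype
  exact ⟨Nat.sSup_mem ⟨_, 0, D.zero_mem, rfl⟩ hb, fun _ hd => le_csSup hb hd⟩

/-- The number `ρ_r(1, m)`: the covering radius of `R_q(1, m)` in `R_q(r, m)`. -/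
noncomputable def rhoOne (F : Type*) [Field F] [Fintype F] [DecidableEq F] (r m : ℕ) : ℕ :=
  coveringRadiusIn (reedMuller F 1 m) (reedMuller F r m)

/-! Modulo affine functions, a word of order 2 is a quadratic form `Q`, so its distance to
`R_q(1,m)` is `q^m` minus the largest number of zeros of `Q + L + c` over affine `L + c`. It remains
to show that the minimum over `Q` of this largest number is `q^(m-1) + q^(⌈m/2⌉-1)`:
`exists_many_zeros` shows that no form does better, `exists_few_zeros` that some form attains it.
Both rest on `card_zeros_hyperbolic_add`: adding a hyperbolic plane in two new variables multiplies
the excess of the zero count over (number of points)/`q` by `q`, exactly as the claimed excess grows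
when the dimension rises by 2. Hence only small dimensions need separate treatment:
Chevalley–Warning makes anisotropic forms at most binary, and the extremal forms are hyperbolic
planes plus an anisotropic form of dimension 1 or 2. -/

/-! ### Zeros of a hyperbolic plane plus a function of other variables -/

theorem card_hyperbola {F : Type*} [Field F] [Fintype F] [DecidableEq F] (a : F) :
    Nat.card {p : F × F // p.1 * p.2 + a = 0} =
      (Fintype.card F - 1) + if a = 0 then Fintype.card F else 0 := by
  have h1 : ∀ x : F, (Finset.univ.filter fun y : F => x * y + a = 0).card =
      if x = 0 then (if a = 0 then Fintype.card F else 0) else 1 := by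
    intro x
    split_ifs with hx ha
    · simp [hx, ha]
    · simp [hx, ha]
    · rw [Finset.card_eq_one]
      refine ⟨-a / x, ?_⟩
      ext y
      simp only [Finset.mem_filter, Finset.mem_univ, true_and, Finset.mem_singleton]
      rw [eq_div_iff hx, mul_comm y x, eq_neg_iff_add_eq_zero]
  rw [Nat.card_eq_fintype_card, Fintype.card_subtype, Finset.card_filter, Fintype.sum_prod_type]
  rw [Finset.sum_congr rfl fun x _ => (Finset.card_filter _ _).symm.trans (h1 x)]
  rw [← Finset.add_sum_erase _ _ (Finset.mem_univ (0 : F)), if_pos rfl,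
    Finset.sum_congr rfl (g := fun _ => 1) (fun x hx => if_neg (Finset.ne_of_mem_erase hx))]
  simp [Finset.card_erase_of_mem, add_comm]

/-- The number of zeros of the sum of a hyperbolic plane and an arbitrary function. -/
theorem card_zeros_hyperbolic_add {F W : Type*} [Field F] [Fintype F] [Finite W] (g : W → F) :
    Nat.card {p : F × F × W // p.1 * p.2.1 + g p.2.2 = 0} =
      Fintype.card F * Nat.card {w // g w = 0} + (Fintype.card F - 1) * Nat.card W := by
  classical
  have := Fintype.ofFinite W
  have e : {p : F × F × W // p.1 * p.2.1 + g p.2.2 = 0} ≃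
      Σ w : W, {p : F × F // p.1 * p.2 + g w = 0} :=
    { toFun := fun p => ⟨p.1.2.2, (p.1.1, p.1.2.1), p.2⟩
      invFun := fun p => ⟨(p.2.1.1, p.2.1.2, p.1), p.2.2⟩
      left_inv := fun _ => rfl
      right_inv := fun _ => rfl }
  rw [Nat.card_congr e, Nat.card_sigma]
  simp_rw [card_hyperbola, Finset.sum_add_distrib]
  rw [Nat.card_eq_fintype_card, Nat.card_eq_fintype_card, Fintype.card_subtype,
    ← Finset.sum_filter]
  simp [mul_comm, add_comm]

/-! ### Isotropic vectors and hyperbolic splitting -/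

theorem toQuadraticMap_sum_smul {ι R M : Type*} [Fintype ι] [CommRing R] [AddCommGroup M]
    [Module R M] (B : LinearMap.BilinMap R M R) (b : ι → M) (x : ι → R) :
    B.toQuadraticMap (∑ i, x i • b i) = ∑ i, ∑ j, B (b i) (b j) * (x i * x j) := by
  rw [LinearMap.BilinMap.toQuadraticMap_apply, map_sum B, LinearMap.sum_apply]
  refine Finset.sum_congr rfl fun i _ => ?_
  rw [map_sum]
  refine Finset.sum_congr rfl fun j _ => ?_
  rw [map_smul, map_smul, LinearMap.smul_apply, smul_eq_mul, smul_eq_mul]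
  ring

/-- Chevalley–Warning: in coordinates the form has degree at most 2, less than the number of
variables, so the characteristic divides its number of zeros, and the zero vector is not the only
one. -/
theorem exists_isotropic_of_two_lt_finrank {F V : Type*} [Field F] [Fintype F] [AddCommGroup V]
    [Module F V] [FiniteDimensional F V] (Q : QuadraticForm F V)
    (h : 2 < Module.finrank F V) : ∃ e : V, e ≠ 0 ∧ Q e = 0 := by
  classical
  obtain ⟨B, rfl⟩ := LinearMap.BilinMap.toQuadraticMap_surjective Q
  let b := Module.finBasis F V
  let P : MvPolynomial (Fin (Module.finrank F V)) F := ∑ i, ∑ j, C (B (b i) (b j)) * (X i * X j)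
  have hP : ∀ x, eval x P = B.toQuadraticMap (b.equivFun.symm x) := by
    intro x
    rw [Module.Basis.equivFun_symm_apply, toQuadraticMap_sum_smul]
    simp [P]
  have hd : P.totalDegree < Fintype.card (Fin (Module.finrank F V)) := by
    rw [Fintype.card_fin]
    refine lt_of_le_of_lt ?_ h
    refine totalDegree_finsetSum_le fun i _ => totalDegree_finsetSum_le fun j _ => ?_
    refine (totalDegree_mul _ _).trans ?_
    rw [totalDegree_C, zero_add]
    refine (totalDegree_mul _ _).trans ?_
    simp [totalDegree_X]
  obtain ⟨p, hp⟩ := CharP.exists F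
  have := Fact.mk (CharP.char_is_prime F p)
  have h2 := char_dvd_card_solutions p hd
  have h0 : eval (0 : Fin (Module.finrank F V) → F) P = 0 := by rw [hP]; simp
  have : 1 < Fintype.card {x // eval x P = 0} :=
    lt_of_lt_of_le (CharP.char_is_prime F p).one_lt
      (Nat.le_of_dvd (Fintype.card_pos_iff.2 ⟨⟨0, h0⟩⟩) h2)
  obtain ⟨x, hx⟩ := Fintype.exists_ne_of_one_lt_card this ⟨0, h0⟩
  refine ⟨b.equivFun.symm x.1, ?_, ?_⟩
  · intro h
    exact hx (Subtype.ext (b.equivFun.symm.map_eq_zero_iff.1 h))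
  · rw [← hP]; exact x.2

/-- A nonzero isotropic vector outside the radical of the polar form splits off a hyperbolic
plane. -/
theorem exists_equiv_hyperbolic_prod {F V : Type*} [Field F] [AddCommGroup V] [Module F V]
    (Q : QuadraticForm F V) {e v : V} (he : Q e = 0) (hv : QuadraticMap.polar Q e v ≠ 0) :
    ∃ (W : Submodule F V) (φ : (F × F × W) ≃ₗ[F] V),
      ∀ x y w, Q (φ (x, y, w)) = x * y + Q w := by
  let B := Q.polarBilin
  have hB : ∀ x y, B x y = QuadraticMap.polar Q x y := fun _ _ => rfl
  have hs : ∀ x y, B x y = B y x := fun x y => QuadraticMap.polar_comm Q x y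
  have hself : ∀ x, B x x = 2 * Q x := fun x => by
    rw [hB, QuadraticMap.polar_self]; simp [two_mul]
  have hadd : ∀ x y, Q (x + y) = Q x + Q y + B x y := fun x y => by
    rw [hB]; exact QuadraticMap.map_add Q x y
  obtain ⟨u, hu⟩ : ∃ u, B e u = 1 := ⟨(B e v)⁻¹ • v, by
    rw [map_smul, smul_eq_mul]; exact inv_mul_cancel₀ hv⟩
  obtain ⟨f, hf, hef⟩ : ∃ f, Q f = 0 ∧ B e f = 1 := by
    -- Since `Q e = 0` and `B e u = 1`, `Q (u + t • e) = Q u + t`. No division by 2 occurs, so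
    -- characteristic 2 is covered.
    refine ⟨u + (-Q u) • e, ?_, ?_⟩
    · rw [hadd, QuadraticMap.map_smul, he, map_smul, hs u e, hu]; simp
    · rw [map_add, map_smul, hself, he, hu]; simp
  have hee : B e e = 0 := by rw [hself, he, mul_zero]
  have hff : B f f = 0 := by rw [hself, hf, mul_zero]
  have hfe : B f e = 1 := by rw [hs, hef]
  let W : Submodule F V := LinearMap.ker (B e) ⊓ LinearMap.ker (B f)
  have hW : ∀ w : W, B e w = 0 ∧ B f w = 0 := fun w => w.2
  let g : (F × F × W) →ₗ[F] V :=
    LinearMap.coprod (LinearMap.toSpanSingleton F V e)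
      (LinearMap.coprod (LinearMap.toSpanSingleton F V f) W.subtype)
  have hg : ∀ x y w, g (x, y, w) = x • e + (y • f + w) := fun _ _ _ => rfl
  have h1 : ∀ x y w, B e (g (x, y, w)) = y := fun x y w => by
    rw [hg]; simp [hee, hef, (hW w).1]
  have h2 : ∀ x y w, B f (g (x, y, w)) = x := fun x y w => by
    rw [hg]; simp [hff, hfe, (hW w).2]
  have hinj : Function.Injective g := by
    rw [injective_iff_map_eq_zero]
    rintro ⟨x, y, w⟩ h
    have hy := h1 x y w
    have hx := h2 x y w
    rw [h, map_zero] at hx hy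
    subst hx hy
    rw [hg] at h
    simpa using h
  have hsurj : Function.Surjective g := by
    intro z
    refine ⟨(B f z, B e z, ⟨z - B f z • e - B e z • f, ?_, ?_⟩), ?_⟩
    · simp [hee, hef]
    · simp [hff, hfe]
    · rw [hg]; simp
  refine ⟨W, LinearEquiv.ofBijective g ⟨hinj, hsurj⟩, fun x y w => ?_⟩
  change Q (g (x, y, w)) = _
  rw [hg, hadd, hadd, QuadraticMap.map_smul, QuadraticMap.map_smul, he, hf]
  simp [hef, (hW w).1, (hW w).2, add_comm]

/-! ### Many zeros after an affine change -/

/-- Pigeonhole: `q² - 1` nonzero vectors share `q - 1` nonzero values, so some value is taken more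
than `q` times. -/
theorem exists_many_zeros_of_anisotropic_of_finrank_eq_two {F V : Type*} [Field F] [Fintype F]
    [AddCommGroup V] [Module F V] [FiniteDimensional F V] (Q : QuadraticForm F V)
    (hQ : ∀ e, Q e = 0 → e = 0) (h : Module.finrank F V = 2) :
    ∃ c : F, Fintype.card F + 1 ≤ Nat.card {x // Q x + c = 0} := by
  classical
  have : Finite V := Module.finite_of_finite F
  have := Fintype.ofFinite V
  have hV : Fintype.card V = Fintype.card F ^ 2 := by
    rw [← h]; exact Module.card_eq_pow_finrank
  have hq : 1 < Fintype.card F := Fintype.one_lt_card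
  obtain ⟨b, -, hb⟩ := Finset.exists_lt_card_fiber_of_mul_lt_card_of_maps_to
    (s := Finset.univ.erase (0 : V)) (t := Finset.univ.erase (0 : F)) (f := Q)
    (n := Fintype.card F) (fun a ha => by
      simp only [Finset.mem_erase, Finset.mem_univ, and_true] at ha ⊢
      exact fun h => ha (hQ a h)) (by
      rw [Finset.card_erase_of_mem (Finset.mem_univ _), Finset.card_erase_of_mem
        (Finset.mem_univ _), Finset.card_univ, Finset.card_univ, hV]
      obtain ⟨k, hk⟩ : ∃ k, Fintype.card F = k + 2 := ⟨_, (Nat.sub_add_cancel hq).symm⟩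
      rw [hk, show k + 2 - 1 = k + 1 from rfl, Nat.lt_sub_iff_add_lt]
      nlinarith)
  refine ⟨-b, ?_⟩
  rw [Nat.card_eq_fintype_card, Fintype.card_subtype]
  refine hb.trans_le (Finset.card_le_card fun x hx => ?_)
  simp only [Finset.mem_filter, Finset.mem_univ, true_and] at hx ⊢
  rw [hx.2, add_neg_cancel]

/-- Every quadratic form has a translate by an affine function with many zeros. -/
theorem exists_many_zeros {F : Type*} [Field F] [Fintype F] (n : ℕ) :
    ∀ {V : Type*} [AddCommGroup V] [Module F V] [FiniteDimensional F V] (Q : QuadraticForm F V),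
      Module.finrank F V = n → ∃ (L : V →ₗ[F] F) (c : F),
        Fintype.card F ^ n + Fintype.card F ^ ((n + 1) / 2) ≤
          Fintype.card F * Nat.card {x // Q x + L x + c = 0} := by
  induction n using Nat.strong_induction_on with
  | _ n ih =>
  intro V _ _ _ Q hn
  have : Finite V := Module.finite_of_finite F
  have hq : 1 < Fintype.card F := Fintype.one_lt_card
  by_cases hiso : ∃ e : V, e ≠ 0 ∧ Q e = 0
  · obtain ⟨e, he0, he⟩ := hiso
    by_cases hp : ∃ v, QuadraticMap.polar Q e v ≠ 0
    · obtain ⟨v, hv⟩ := hp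
      obtain ⟨W, φ, hφ⟩ := exists_equiv_hyperbolic_prod Q he hv
      have hd : n = Module.finrank F W + 2 := by
        rw [← hn, ← φ.finrank_eq]; simp; ring
      obtain ⟨L, c, hL⟩ := ih _ (by omega) (Q.comp W.subtype) rfl
      refine ⟨L ∘ₗ LinearMap.snd F F W ∘ₗ LinearMap.snd F F (F × W) ∘ₗ φ.symm.toLinearMap, c, ?_⟩
      have e1 : {p : F × F × W // p.1 * p.2.1 + (Q p.2.2 + L p.2.2 + c) = 0} ≃
          {x : V // Q x + (L ∘ₗ LinearMap.snd F F W ∘ₗ LinearMap.snd F F (F × W) ∘ₗ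
            φ.symm.toLinearMap) x + c = 0} :=
        φ.toEquiv.subtypeEquiv (by
          rintro ⟨x, y, w⟩
          have := hφ x y w
          simp [this, add_assoc])
      rw [← Nat.card_congr e1, card_zeros_hyperbolic_add (fun w : W => Q w + L w + c),
        Module.natCard_eq_pow_finrank (K := F) (V := W), Nat.card_eq_fintype_card (α := F)]
      simp only [QuadraticMap.comp_apply, Submodule.subtype_apply] at hL
      rw [hd, show (Module.finrank F W + 2 + 1) / 2 = (Module.finrank F W + 1) / 2 + 1 by omega]
      obtain ⟨k, hk⟩ : ∃ k, Fintype.card F = k + 1 := ⟨_, (Nat.sub_add_cancel hq.le).symm⟩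
      rw [hk] at hL ⊢
      rw [Nat.add_sub_cancel, pow_add, pow_succ _ ((Module.finrank F W + 1) / 2)]
      have := Nat.mul_le_mul_left (k + 1) hL
      nlinarith
    -- Here `e` is isotropic and in the radical of the polar form, so `Q` is constant along `e`. A
    -- translate chosen on a complement therefore has its zero count multiplied by `q`.
    · push Not at hp
      obtain ⟨W, hW⟩ := Submodule.exists_isCompl (F ∙ e)
      let φ := (LinearEquiv.toSpanNonzeroSingleton F V e he0).prodCongr (LinearEquiv.refl F W)
        ≪≫ₗ Submodule.prodEquivOfIsCompl _ _ hW
      have hφ : ∀ t w, φ (t, w) = t • e + w := fun t w => by simp [φ]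
      have hQ : ∀ t w, Q (φ (t, w)) = Q w := fun t w => by
        rw [hφ, QuadraticMap.map_add Q, QuadraticMap.map_smul, he, QuadraticMap.polar_smul_left, hp]
        simp
      have hd : n = Module.finrank F W + 1 := by
        rw [← hn, ← φ.finrank_eq]; simp; ring
      obtain ⟨L, c, hL⟩ := ih _ (by omega) (Q.comp W.subtype) rfl
      refine ⟨L ∘ₗ LinearMap.snd F F W ∘ₗ φ.symm.toLinearMap, c, ?_⟩
      have e1 : F × {w : W // Q w + L w + c = 0} ≃
          {x : V // Q x + (L ∘ₗ LinearMap.snd F F W ∘ₗ φ.symm.toLinearMap) x + c = 0} :=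
        { toFun := fun p => ⟨φ (p.1, p.2.1), by simp [hQ, p.2.2]⟩
          invFun := fun x => ((φ.symm x.1).1, ⟨(φ.symm x.1).2, by
            have h1 := x.2
            rw [← φ.apply_symm_apply x.1] at h1
            rw [← Prod.mk.eta (p := φ.symm x.1), hQ] at h1
            simpa using h1⟩)
          left_inv := fun p => by simp
          right_inv := fun x => Subtype.ext (φ.apply_symm_apply x.1) }
      rw [← Nat.card_congr e1, Nat.card_prod, Nat.card_eq_fintype_card (α := F)]
      simp only [QuadraticMap.comp_apply, Submodule.subtype_apply] at hL
      rw [hd]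
      refine le_trans ?_ (Nat.mul_le_mul_left _ hL)
      rw [mul_add, pow_succ']
      refine Nat.add_le_add_left ?_ _
      rw [← pow_succ']
      exact Nat.pow_le_pow_right hq.le (by omega)
  · have hiso' : ∀ e, Q e = 0 → e = 0 := fun e he => by
      by_contra h
      exact hiso ⟨e, h, he⟩
    have h2 : n ≤ 2 := by
      by_contra h
      exact hiso (exists_isotropic_of_two_lt_finrank Q (by omega))
    interval_cases n
    · refine ⟨0, 0, ?_⟩
      have : 1 ≤ Nat.card {x // Q x + (0 : V →ₗ[F] F) x + 0 = 0} :=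
        Nat.card_pos_iff.2 ⟨⟨⟨0, by simp⟩⟩, inferInstance⟩
      simp only [pow_zero, zero_add, Nat.reduceDiv]
      nlinarith
    · obtain ⟨v, hv, -⟩ := finrank_eq_one_iff'.1 hn
      -- Two zeros suffice in dimension 1; with `L v = 1`, subtracting `Q v • L` makes `v` a zero
      -- besides `0`.
      obtain ⟨L, hL⟩ := Module.Projective.exists_dual_eq_one F hv
      have h0 : Q 0 + (-Q v • L) 0 + 0 = 0 := by simp
      have h1 : Q v + (-Q v • L) v + 0 = 0 := by simp [hL]
      refine ⟨-Q v • L, 0, ?_⟩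
      have : 1 < Nat.card {x // Q x + (-Q v • L) x + 0 = 0} :=
        Finite.one_lt_card_iff_nontrivial.2
          ⟨⟨0, h0⟩, ⟨v, h1⟩, fun h => hv (congrArg Subtype.val h).symm⟩
      simp only [pow_one, Nat.reduceAdd, Nat.reduceDiv]
      nlinarith
    · obtain ⟨c, hc⟩ := exists_many_zeros_of_anisotropic_of_finrank_eq_two Q hiso' hn
      refine ⟨0, c, ?_⟩
      simp only [LinearMap.zero_apply, add_zero, Nat.reduceAdd, Nat.reduceDiv, pow_one]
      nlinarith

/-! ### Extremal forms with few zeros -/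

theorem card_quadratic_roots_le_two {F : Type*} [Field F] [Finite F] (a b : F) :
    Nat.card {x : F // x * x + a * x + b = 0} ≤ 2 := by
  classical
  have := Fintype.ofFinite F
  rw [Nat.card_eq_fintype_card, Fintype.card_subtype]
  rcases Finset.eq_empty_or_nonempty
    (Finset.univ.filter fun x : F => x * x + a * x + b = 0) with h | ⟨x₀, h₀⟩
  · simp [h]
  · refine (Finset.card_le_card (t := {x₀, -a - x₀}) fun x hx => ?_).trans Finset.card_le_two
    simp only [Finset.mem_filter, Finset.mem_univ, true_and, Finset.mem_insert,
      Finset.mem_singleton] at hx h₀ ⊢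
    have : (x - x₀) * (x - (-a - x₀)) = 0 := by linear_combination hx - h₀
    rcases mul_eq_zero.1 this with h | h
    · exact Or.inl (sub_eq_zero.1 h)
    · exact Or.inr (sub_eq_zero.1 h)

/-- The map `x ↦ x² - x` identifies 0 and 1, so on a finite field it is not surjective. This gives
an anisotropic binary form in every characteristic. -/
theorem exists_sq_sub_self_ne (F : Type*) [Field F] [Finite F] :
    ∃ d : F, ∀ x : F, x * x - x ≠ d := by
  by_contra! h
  have hinj := (Finite.injective_iff_surjective (f := fun x : F => x * x - x)).2 h
  exact zero_ne_one (hinj (a₁ := 0) (a₂ := 1) (by simp))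

/-- An affine conic whose homogeneous part `x² - xy - dy²` is anisotropic has at most `q + 1`
points. -/
theorem card_conic_le {F : Type*} [Field F] [Fintype F] {d : F} (hd : ∀ x : F, x * x - x ≠ d)
    (a b c : F) :
    Nat.card {p : F × F // p.1 * p.1 - p.1 * p.2 - d * (p.2 * p.2) + (a * p.1 + b * p.2) + c = 0} ≤
      Fintype.card F + 1 := by
  classical
  have haniso : ∀ x y : F, x * x - x * y - d * (y * y) = 0 → x = 0 ∧ y = 0 := by
    intro x y h
    by_cases hy : y = 0
    · subst hy
      simpa using h
    · refine absurd ?_ (hd (x / y))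
      field_simp
      linear_combination h
  rcases isEmpty_or_nonempty
    {p : F × F // p.1 * p.1 - p.1 * p.2 - d * (p.2 * p.2) + (a * p.1 + b * p.2) + c = 0}
    with h | ⟨⟨⟨x₀, y₀⟩, h₀⟩⟩
  · simp
  -- After translating the point `(x₀, y₀)` to the origin the linear part is `s * x + t * y`.
  obtain ⟨s, hs⟩ : ∃ s, s = 2 * x₀ - y₀ + a := ⟨_, rfl⟩
  obtain ⟨t, ht⟩ : ∃ t, t = -x₀ - 2 * d * y₀ + b := ⟨_, rfl⟩
  have key : ∀ x y : F, x * x - x * y - d * (y * y) + (a * x + b * y) + c = 0 →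
      (x - x₀) * (x - x₀) - (x - x₀) * (y - y₀) - d * ((y - y₀) * (y - y₀)) +
        (s * (x - x₀) + t * (y - y₀)) = 0 := by
    intro x y h
    simp only at h₀
    rw [hs, ht]
    linear_combination h - h₀
  -- A second linear form, independent of the tangent form `(s, t)`, to parametrize the conic by the
  -- slopes of chords through the base point. If `s = t = 0`, anisotropy leaves only the base point.
  obtain ⟨s', t', hdet⟩ : ∃ s' t' : F, (s = 0 ∧ t = 0) ∨ s * t' - t * s' ≠ 0 := by
    by_cases h1 : s = 0
    · by_cases h2 : t = 0
      · exact ⟨0, 0, Or.inl ⟨h1, h2⟩⟩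
      · exact ⟨1, 0, Or.inr (by simpa using h2)⟩
    · exact ⟨0, 1, Or.inr (by simpa using h1)⟩
  have ratio : ∀ x y z w : F, x * x - x * y - d * (y * y) + (s * x + t * y) = 0 →
      z * z - z * w - d * (w * w) + (s * z + t * w) = 0 → s * x + t * y ≠ 0 →
      s * z + t * w ≠ 0 → s * t' - t * s' ≠ 0 →
      (s' * x + t' * y) * (s * z + t * w) = (s' * z + t' * w) * (s * x + t * y) →
      x = z ∧ y = w := by
    intro x y z w k1 k2 d1 d2 hne hgg
    have hxw : x * w = y * z := by
      refine mul_left_cancel₀ hne ?_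
      linear_combination -hgg
    have e1 : (s * x + t * y) * z = (s * z + t * w) * x := by linear_combination -t * hxw
    have e2 : (s * x + t * y) * w = (s * z + t * w) * y := by linear_combination s * hxw
    -- The two points are proportional; comparing the degree 2 and degree 1 parts of the equation
    -- forces the factor to be 1.
    have hl : s * x + t * y = s * z + t * w := by
      generalize s * x + t * y = l at *
      generalize s * z + t * w = k at *
      refine mul_left_cancel₀ (mul_ne_zero d1 d2) ?_
      linear_combination l ^ 2 * k2 - k ^ 2 * k1 - (l * z + k * x - l * w) * e1
        + (k * x + d * (l * w + k * y)) * e2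
    rw [hl] at e1 e2
    exact ⟨(mul_left_cancel₀ d2 e1).symm, (mul_left_cancel₀ d2 e2).symm⟩
  -- The base point goes to `none`; at any other point the denominator is nonzero by anisotropy.
  let g : {p : F × F // p.1 * p.1 - p.1 * p.2 - d * (p.2 * p.2) + (a * p.1 + b * p.2) + c = 0} →
      Option F := fun p => if p.1 = (x₀, y₀) then none else
        some ((s' * (p.1.1 - x₀) + t' * (p.1.2 - y₀)) / (s * (p.1.1 - x₀) + t * (p.1.2 - y₀)))
  have hg : Function.Injective g := by
    rintro ⟨⟨x, y⟩, h⟩ ⟨⟨z, w⟩, h'⟩ hgg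
    simp only [g] at hgg
    have k1 := key x y h
    have k2 := key z w h'
    have n1 : ∀ u v : F, u * u - u * v - d * (v * v) + (s * u + t * v) = 0 →
        (s * u + t * v) = 0 → u = 0 ∧ v = 0 := fun u v h h' =>
      haniso u v (by linear_combination h - h')
    split_ifs at hgg with c1 c2 c2
    · exact Subtype.ext (c1.trans c2.symm)
    · have d1 : s * (x - x₀) + t * (y - y₀) ≠ 0 := fun h0 => c1 (by
        have := n1 _ _ k1 h0
        exact Prod.ext (sub_eq_zero.1 this.1) (sub_eq_zero.1 this.2))
      have d2 : s * (z - x₀) + t * (w - y₀) ≠ 0 := fun h0 => c2 (by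
        have := n1 _ _ k2 h0
        exact Prod.ext (sub_eq_zero.1 this.1) (sub_eq_zero.1 this.2))
      have hne : s * t' - t * s' ≠ 0 := hdet.resolve_left (by
        rintro ⟨rfl, rfl⟩
        simp at d1)
      rw [Option.some.injEq, div_eq_div_iff d1 d2] at hgg
      have hc := ratio _ _ _ _ k1 k2 d1 d2 hne hgg
      exact Subtype.ext (Prod.ext (sub_left_injective hc.1) (sub_left_injective hc.2))
  have := Nat.card_le_card_of_injective g hg
  simpa using this

/-- The bound of `exists_many_zeros` is attained. -/
theorem exists_few_zeros (F : Type*) [Field F] [Fintype F] (n : ℕ) (hn : 1 ≤ n) :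
    ∃ Q : QuadraticForm F (Fin n → F), ∀ (L : (Fin n → F) →ₗ[F] F) (c : F),
      Fintype.card F * Nat.card {x // Q x + L x + c = 0} ≤
        Fintype.card F ^ n + Fintype.card F ^ ((n + 1) / 2) := by
  have transport : ∀ {n K : ℕ} {V : Type _} [AddCommGroup V] [Module F V] [FiniteDimensional F V],
      Module.finrank F V = n → (∃ Q : QuadraticForm F V, ∀ (L : V →ₗ[F] F) (c : F),
        Fintype.card F * Nat.card {x // Q x + L x + c = 0} ≤ K) →
      ∃ Q : QuadraticForm F (Fin n → F), ∀ (L : (Fin n → F) →ₗ[F] F) (c : F),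
        Fintype.card F * Nat.card {x // Q x + L x + c = 0} ≤ K := by
    rintro n K V _ _ _ hV ⟨Q, hQ⟩
    let φ : (Fin n → F) ≃ₗ[F] V := LinearEquiv.ofFinrankEq _ _ (by simp [hV])
    refine ⟨Q.comp φ.toLinearMap, fun L c => ?_⟩
    have e : {x // Q.comp φ.toLinearMap x + L x + c = 0} ≃
        {x // Q x + (L ∘ₗ φ.symm.toLinearMap) x + c = 0} :=
      φ.toEquiv.subtypeEquiv (by simp)
    rw [Nat.card_congr e]
    exact hQ _ c
  have hq : 1 < Fintype.card F := Fintype.one_lt_card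
  induction n using Nat.twoStepInduction with
  | zero => omega
  | one =>
    refine transport (V := F) (by simp) ⟨QuadraticMap.sq, fun L c => ?_⟩
    obtain ⟨a, e⟩ : ∃ a, ∀ x, L x = a * x := ⟨L 1, fun x => by
      rw [mul_comm, ← smul_eq_mul, ← map_smul, smul_eq_mul, mul_one]⟩
    have := card_quadratic_roots_le_two a c
    simp only [QuadraticMap.sq_apply, e, pow_one, Nat.reduceAdd, Nat.reduceDiv]
    nlinarith
  | more n ih _ =>
    -- Dimension 2 is a base case: the bound fails in dimension 0 once `q > 2`, so the induction
    -- cannot start there.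
    rcases Nat.eq_zero_or_pos n with rfl | hn'
    · obtain ⟨d, hd⟩ := exists_sq_sub_self_ne F
      refine transport (V := F × F) (by simp)
        ⟨QuadraticMap.linMulLin (LinearMap.fst F F F) (LinearMap.fst F F F)
          - QuadraticMap.linMulLin (LinearMap.fst F F F) (LinearMap.snd F F F)
          - d • QuadraticMap.linMulLin (LinearMap.snd F F F) (LinearMap.snd F F F),
          fun L c => ?_⟩
      obtain ⟨a, b, e⟩ : ∃ a b, ∀ p : F × F, L p = a * p.1 + b * p.2 :=
        ⟨L (1, 0), L (0, 1), fun p => by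
          rw [mul_comm, mul_comm (L (0, 1)), ← smul_eq_mul, ← smul_eq_mul, ← map_smul, ← map_smul,
            ← map_add]
          simp⟩
      have := card_conic_le hd a b c
      simp only [sub_apply, smul_apply, QuadraticMap.linMulLin_apply, LinearMap.fst_apply,
        LinearMap.snd_apply, smul_eq_mul, e, Nat.zero_add, Nat.reduceAdd, Nat.reduceDiv, pow_one]
      nlinarith
    · obtain ⟨Q, hQ⟩ := ih hn'
      refine transport (V := F × F × (Fin n → F)) (by simp; ring)
        ⟨QuadraticMap.linMulLin (LinearMap.fst F F _)
            (LinearMap.fst F F _ ∘ₗ LinearMap.snd F F (F × (Fin n → F)))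
          + Q.comp (LinearMap.snd F F _ ∘ₗ LinearMap.snd F F (F × (Fin n → F))),
          fun L c => ?_⟩
      obtain ⟨a, ha⟩ : ∃ a, a = L (1, 0, 0) := ⟨_, rfl⟩
      obtain ⟨b, hb⟩ : ∃ b, b = L (0, 1, 0) := ⟨_, rfl⟩
      let M : (Fin n → F) →ₗ[F] F := L ∘ₗ LinearMap.inr F F _ ∘ₗ LinearMap.inr F F _
      have e : ∀ x y w, L (x, y, w) = a * x + b * y + M w := fun x y w => by
        have : ((x, y, w) : F × F × (Fin n → F)) = x • (1, 0, 0) + y • (0, 1, 0) + (0, 0, w) := by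
          ext <;> simp
        rw [this, map_add, map_add, map_smul, map_smul, smul_eq_mul, smul_eq_mul, ha, hb]
        simp only [M, LinearMap.comp_apply, LinearMap.inr_apply]
        ring
      -- `xy + ax + by + c = (x + b)(y + a) + (c - ab)`: a translation absorbs the linear terms on
      -- the hyperbolic plane.
      let g : (Fin n → F) → F := fun w => Q w + M w + (c - a * b)
      have e1 : {x : F × F × (Fin n → F) // (QuadraticMap.linMulLin (LinearMap.fst F F _)
            (LinearMap.fst F F _ ∘ₗ LinearMap.snd F F (F × (Fin n → F)))
          + Q.comp (LinearMap.snd F F _ ∘ₗ LinearMap.snd F F (F × (Fin n → F)))) x + L x + c = 0} ≃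
          {p : F × F × (Fin n → F) // p.1 * p.2.1 + g p.2.2 = 0} :=
        ((Equiv.addRight b).prodCongr ((Equiv.addRight a).prodCongr (Equiv.refl _))).subtypeEquiv
          (by
            rintro ⟨x, y, w⟩
            refine Eq.congr_left ?_
            simp only [add_apply, QuadraticMap.linMulLin_apply, LinearMap.fst_apply,
              LinearMap.comp_apply, LinearMap.snd_apply, QuadraticMap.comp_apply, e,
              Equiv.prodCongr_apply, Prod.map, Equiv.coe_addRight, Equiv.refl_apply, g]
            ring)
      have hN := hQ M (c - a * b)
      rw [Nat.card_congr e1, card_zeros_hyperbolic_add, Nat.card_eq_fintype_card (α := Fin n → F),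
        Fintype.card_fun, Fintype.card_fin, show (n + 2 + 1) / 2 = (n + 1) / 2 + 1 by omega]
      obtain ⟨k, hk⟩ : ∃ k, Fintype.card F = k + 1 := ⟨_, (Nat.sub_add_cancel hq.le).symm⟩
      rw [hk] at hN ⊢
      rw [Nat.add_sub_cancel, pow_add, pow_succ _ ((n + 1) / 2)]
      have := Nat.mul_le_mul_left (k + 1) hN
      nlinarith

/-! ### Reed–Muller codes of order 1 and 2 as affine and quadratic functions -/

section ReedMuller

variable {F : Type*} [Field F] [Fintype F] {m : ℕ}

theorem const_mem_reedMuller (r : ℕ) (c : F) : (fun _ => c) ∈ reedMuller F r m := by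
  rw [mem_reedMuller]
  exact ⟨C c, by simp, by simp, by simp⟩

theorem coord_mem_reedMuller {r : ℕ} (hr : 1 ≤ r) (i : Fin m) :
    (fun x => x i) ∈ reedMuller F r m := by
  classical
  rw [mem_reedMuller]
  have hq : 1 < Fintype.card F := Fintype.one_lt_card
  refine ⟨X i, fun j => ?_, by simpa using hr, by simp⟩
  rw [degreeOf_X]
  split_ifs <;> omega

theorem coord_mul_coord_mem_reedMuller (i j : Fin m) :
    (fun x => x i * x j) ∈ reedMuller F 2 m := by
  classical
  have hq : 1 < Fintype.card F := Fintype.one_lt_card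
  by_cases h : i = j ∧ Fintype.card F = 2
  -- Over the field with two elements `X i ^ 2` is not reduced, but it represents the same function
  -- as `X i`.
  · obtain ⟨rfl, h2⟩ := h
    convert coord_mem_reedMuller (F := F) one_le_two i using 2 with x
    rw [← pow_two, ← h2, FiniteField.pow_card]
  · rw [mem_reedMuller]
    refine ⟨X i * X j, fun k => ?_, (totalDegree_mul _ _).trans (by simp), by simp⟩
    refine (degreeOf_mul_le _ _ _).trans ?_
    rw [degreeOf_X, degreeOf_X]
    split_ifs with h1 h2
    · have : Fintype.card F ≠ 2 := fun h3 => h ⟨h1.symm.trans h2, h3⟩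
      omega
    all_goals omega

theorem linearMap_mem_reedMuller (L : (Fin m → F) →ₗ[F] F) : ⇑L ∈ reedMuller F 1 m := by
  have : ⇑L = ∑ i, L (Pi.single i 1) • fun x : Fin m → F => x i := by
    ext x
    conv_lhs => rw [pi_eq_sum_univ' x]
    simp [Finset.sum_apply, mul_comm]
  rw [this]
  exact Submodule.sum_mem _ fun i _ => Submodule.smul_mem _ _ (coord_mem_reedMuller le_rfl i)

theorem quadraticForm_mem_reedMuller (Q : QuadraticForm F (Fin m → F)) :
    ⇑Q ∈ reedMuller F 2 m := by
  obtain ⟨B, rfl⟩ := LinearMap.BilinMap.toQuadraticMap_surjective Q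
  have : ⇑B.toQuadraticMap = ∑ i, ∑ j, B (Pi.single i 1) (Pi.single j 1) •
      fun x : Fin m → F => x i * x j := by
    ext x
    conv_lhs => rw [pi_eq_sum_univ' x]
    rw [toQuadraticMap_sum_smul]
    simp [Finset.sum_apply]
  rw [this]
  exact Submodule.sum_mem _ fun i _ => Submodule.sum_mem _ fun j _ =>
    Submodule.smul_mem _ _ (coord_mul_coord_mem_reedMuller i j)

theorem mem_of_mem_reedMuller {r : ℕ} {f : (Fin m → F) → F} (hf : f ∈ reedMuller F r m)
    (S : Submodule F ((Fin m → F) → F))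
    (hS : ∀ s : Fin m → ℕ, ∑ i, s i ≤ r → (fun x => ∏ i, x i ^ s i) ∈ S) : f ∈ S := by
  obtain ⟨P, -, hP, hPf⟩ := (mem_reedMuller F r m f).1 hf
  have : f = ∑ s ∈ P.support, P.coeff s • fun x => ∏ i, x i ^ s i := by
    ext x
    rw [← hPf, eval_eq']
    simp [Finset.sum_apply]
  rw [this]
  refine Submodule.sum_mem _ fun s hs => Submodule.smul_mem _ _ (hS s ?_)
  refine le_trans ?_ ((le_totalDegree hs).trans hP)
  rw [Finsupp.sum_fintype _ _ (fun _ => rfl)]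

theorem prod_pow_eq_one_or_exists_mul {F : Type*} [Field F] {m : ℕ}
    {s : Fin m → ℕ} {r : ℕ} (hs : ∑ i, s i ≤ r + 1) :
    (∀ x : Fin m → F, ∏ i, x i ^ s i = 1) ∨ ∃ (i : Fin m) (s' : Fin m → ℕ), ∑ i, s' i ≤ r ∧
      ∀ x : Fin m → F, ∏ i, x i ^ s i = x i * ∏ i, x i ^ s' i := by
  classical
  by_cases h : ∃ i, s i ≠ 0
  · obtain ⟨i, hi⟩ := h
    obtain ⟨s', rfl⟩ : ∃ s' : Fin m → ℕ, s = s' + Pi.single i 1 := by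
      refine ⟨s - Pi.single i 1, funext fun j => ?_⟩
      by_cases hj : j = i
      · subst hj
        simp only [Pi.add_apply, Pi.sub_apply, Pi.single_eq_same]
        omega
      · simp [hj]
    refine Or.inr ⟨i, s', ?_, fun x => ?_⟩
    · simpa [Finset.sum_add_distrib] using hs
    · simp only [Pi.add_apply, pow_add, Finset.prod_mul_distrib]
      rw [mul_comm]
      congr 1
      rw [Finset.prod_eq_single i] <;> simp +contextual
  · push Not at h
    exact Or.inl fun x => by simp [h]

theorem prod_pow_eq_one_or_eq_coord {s : Fin m → ℕ} (hs : ∑ i, s i ≤ 1) :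
    (∀ x : Fin m → F, ∏ i, x i ^ s i = 1) ∨ ∃ i, ∀ x : Fin m → F, ∏ i, x i ^ s i = x i := by
  refine (prod_pow_eq_one_or_exists_mul (r := 0) hs).imp_right ?_
  rintro ⟨i, s', h, h'⟩
  have h0 : ∀ i, s' i = 0 := by simpa using h
  exact ⟨i, fun x => by rw [h']; simp [h0]⟩

theorem exists_affine_of_mem_reedMuller {f : (Fin m → F) → F} (hf : f ∈ reedMuller F 1 m) :
    ∃ (L : (Fin m → F) →ₗ[F] F) (c : F), ∀ x, f x = L x + c := by
  let S : Submodule F ((Fin m → F) → F) :=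
    { carrier := {f | ∃ (L : (Fin m → F) →ₗ[F] F) (c : F), ∀ x, f x = L x + c}
      add_mem' := by
        rintro f g ⟨L, c, h⟩ ⟨L', c', h'⟩
        exact ⟨L + L', c + c', fun x => by simp [h, h']; ring⟩
      zero_mem' := ⟨0, 0, by simp⟩
      smul_mem' := by
        rintro a f ⟨L, c, h⟩
        exact ⟨a • L, a * c, fun x => by simp [h]; ring⟩ }
  refine mem_of_mem_reedMuller hf S fun s hs => ?_
  rcases prod_pow_eq_one_or_eq_coord (F := F) hs with h | ⟨i, h⟩
  · exact ⟨0, 1, by simpa using h⟩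
  · exact ⟨LinearMap.proj i, 0, by simpa using h⟩

theorem exists_quadratic_of_mem_reedMuller {f : (Fin m → F) → F} (hf : f ∈ reedMuller F 2 m) :
    ∃ (Q : QuadraticForm F (Fin m → F)) (L : (Fin m → F) →ₗ[F] F) (c : F),
      ∀ x, f x = Q x + L x + c := by
  let S : Submodule F ((Fin m → F) → F) :=
    { carrier := {f | ∃ (Q : QuadraticForm F (Fin m → F)) (L : (Fin m → F) →ₗ[F] F) (c : F),
        ∀ x, f x = Q x + L x + c}
      add_mem' := by
        rintro f g ⟨Q, L, c, h⟩ ⟨Q', L', c', h'⟩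
        exact ⟨Q + Q', L + L', c + c', fun x => by simp [h, h']; ring⟩
      zero_mem' := ⟨0, 0, 0, by simp⟩
      smul_mem' := by
        rintro a f ⟨Q, L, c, h⟩
        exact ⟨a • Q, a • L, a * c, fun x => by simp [h]; ring⟩ }
  refine mem_of_mem_reedMuller hf S fun s hs => ?_
  rcases prod_pow_eq_one_or_exists_mul (F := F) hs with h | ⟨i, s', hs', h⟩
  · exact ⟨0, 0, 1, by simpa using h⟩
  · rcases prod_pow_eq_one_or_eq_coord (F := F) hs' with h' | ⟨j, h'⟩
    · exact ⟨0, LinearMap.proj i, 0, fun x => by simp [h, h']⟩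
    · exact ⟨QuadraticMap.linMulLin (LinearMap.proj i) (LinearMap.proj j), 0, 0,
        fun x => by simp [h, h']⟩

end ReedMuller

/-! ### From zero counts to the covering radius -/

theorem hammingNorm_add_card_zeros {ι F : Type*} [Fintype ι] [Zero F] [DecidableEq F]
    (f : ι → F) : hammingNorm f + Nat.card {x // f x = 0} = Fintype.card ι := by
  rw [Nat.card_eq_fintype_card, Fintype.card_subtype, hammingNorm, add_comm]
  exact Finset.card_filter_add_card_filter_not (s := Finset.univ) fun x => f x = 0

/-- The covering radius, multiplied by `q` to avoid subtraction and division. -/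
theorem card_mul_rhoOne_two (F : Type*) [Field F] [Fintype F] [DecidableEq F] {m : ℕ}
    (hm : 1 ≤ m) :
    Fintype.card F * rhoOne F 2 m + (Fintype.card F ^ m + Fintype.card F ^ ((m + 1) / 2)) =
      Fintype.card F * Fintype.card F ^ m := by
  have hcard : Fintype.card (Fin m → F) = Fintype.card F ^ m := by simp
  obtain ⟨⟨f, hf, hfr⟩, hmax⟩ := isGreatest_coveringRadiusIn (reedMuller F 1 m) (reedMuller F 2 m)
  have hsub : ∀ {f c : (Fin m → F) → F} {Q : QuadraticForm F (Fin m → F)}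
      {L : (Fin m → F) →ₗ[F] F} {a : F}, (∀ x, f x - c x = Q x + L x + a) →
      hammingNorm (f - c) + Nat.card {x // Q x + L x + a = 0} = Fintype.card F ^ m := by
    intro f c Q L a h
    rw [← hcard, ← hammingNorm_add_card_zeros (f - c)]
    simp only [Pi.sub_apply, h]
  apply le_antisymm
  · obtain ⟨Q, L, a, hQ⟩ := exists_quadratic_of_mem_reedMuller hf
    obtain ⟨L', a', hN⟩ := exists_many_zeros m Q (by simp)
    -- Subtracting this codeword trades the affine part `L + a` of `f` for the favourable `L' + a'`.
    have hc : ⇑(L - L') + (fun _ => a - a') ∈ reedMuller F 1 m :=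
      add_mem (linearMap_mem_reedMuller _) (const_mem_reedMuller 1 _)
    have hle : rhoOne F 2 m ≤ _ :=
      hfr.symm.le.trans ((isLeast_distToCode (reedMuller F 1 m) f).2 ⟨_, hc, rfl⟩)
    have h := hsub (f := f) (c := ⇑(L - L') + fun _ => a - a') (Q := Q) (L := L') (a := a')
      (fun x => by simp [hQ]; ring)
    refine (add_le_add (Nat.mul_le_mul_left _ hle) hN).trans_eq ?_
    rw [← mul_add, h]
  · obtain ⟨Q, hQ⟩ := exists_few_zeros F m hm
    obtain ⟨c, hc, hd⟩ := (isLeast_distToCode (reedMuller F 1 m) Q).1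
    obtain ⟨L, a, hL⟩ := exists_affine_of_mem_reedMuller hc
    have hle : hammingNorm (⇑Q - c) ≤ rhoOne F 2 m :=
      hd.le.trans (hmax ⟨Q, quadraticForm_mem_reedMuller Q, rfl⟩)
    have h := hsub (f := Q) (c := c) (Q := Q) (L := -L) (a := -a) (fun x => by simp [hL]; ring)
    refine Eq.trans_le ?_ (add_le_add (Nat.mul_le_mul_left _ hle) (hQ (-L) (-a)))
    rw [← mul_add, h]

theorem ceil_natCast_div_two (m : ℕ) : ⌈(m : ℚ) / 2⌉ = (((m + 1) / 2 : ℕ) : ℤ) := by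
  rw [Int.ceil_eq_iff]
  obtain ⟨k, rfl | rfl⟩ := Nat.even_or_odd' m
  · rw [show (2 * k + 1) / 2 = k by omega]
    push_cast
    constructor <;> linarith
  · rw [show (2 * k + 1 + 1) / 2 = k + 1 by omega]
    push_cast
    constructor <;> linarith

theorem theorem1p2 (F : Type*) [Field F] [Fintype F] [DecidableEq F] (m : ℕ) (hm : 1 ≤ m) :
    (rhoOne F 2 m : ℚ) =
      ((Fintype.card F : ℚ) - 1) * (Fintype.card F : ℚ) ^ ((m : ℤ) - 1)
        - (Fintype.card F : ℚ) ^ (⌈(m : ℚ) / 2⌉ - 1) := by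
  have hq : (Fintype.card F : ℚ) ≠ 0 := Nat.cast_ne_zero.2 Fintype.card_ne_zero
  have h : (Fintype.card F : ℚ) * rhoOne F 2 m +
      ((Fintype.card F : ℚ) ^ m + (Fintype.card F : ℚ) ^ ((m + 1) / 2)) =
        (Fintype.card F : ℚ) * (Fintype.card F : ℚ) ^ m := by
    exact_mod_cast card_mul_rhoOne_two F hm
  rw [ceil_natCast_div_two, zpow_sub₀ hq, zpow_sub₀ hq, zpow_one, zpow_natCast, zpow_natCast]
  field_simp
  linear_combination h
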